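/- All algebras are associative, possibly non-unital algebras over $\mathbb{C}$ that are idempotent ($A^2=A$) and have a non-degenerate product; $M(A)$ is the multiplier algebra, and $\iota$ the identity map. A weak multiplier Hopf algebra (Van Daele–Wang) is such an algebra $A$ with a full coproduct $\Delta:A\to M(A\otimes A)$, that is, a homomorphism such that $T_1(a\otimes b)=\Delta(a)(1\otimes b)$ and $T_2(a\otimes b)=(a\otimes 1)\Delta(b)$ lie in $A\otimes A$ for all $a,b\in A$, which is coassociative, $(c\otimes 1\otimes 1)(\Delta\otimes\iota)(\Delta(a)(1\otimes b))=(\iota\otimes\Delta)((c\otimes 1)\Delta(a))(1\otimes 1\otimes b)$, and such that $\Delta(A)(1\otimes A)\subseteq V\otimes A$ or $(A\otimes 1)\Delta(A)\subseteq A\otimes V$ for a subspace $V\subseteq A$ forces $V=A$; with a counit $\varepsilon:A\to\mathbb{C}$, that is, a linear map with $(\varepsilon\otimes\iota)T_1(a\otimes b)=ab=(\iota\otimes\varepsilon)T_2(a\otimes b)$; and with an idempotent $E\in M(A\otimes A)$ such that $T_1(A\otimes A)=E(A\otimes A)$, $T_2(A\otimes A)=(A\otimes A)E$, $(\iota\otimes\Delta)E=(E\otimes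 1)(1\otimes E)=(1\otimes E)(E\otimes 1)$ (where $\iota\otimes\Delta$ is extended to $M(A\otimes A)$ with $(\iota\otimes\Delta)(1)=1\otimes E$), and $\ker T_i=(1-G_i)(A\otimes A)$ for $i=1,2$, where $G_1,G_2$ are the linear maps on $A\otimes A$ given by $(G_1\otimes\iota)(\Delta_{13}(a)(1\otimes b\otimes c))=\Delta_{13}(a)(1\otimes E)(1\otimes b\otimes c)$ and $(\iota\otimes G_2)((a\otimes b\otimes 1)\Delta_{13}(c))=(a\otimes b\otimes 1)(E\otimes 1)\Delta_{13}(c)$. It is regular if also $\Delta(a)(b\otimes 1)$ and $(1\otimes a)\Delta(b)$ always lie in $A\otimes A$ and $A$ with the flipped coproduct $\Delta^{cop}$ is again a weak multiplier Hopf algebra. We write $\Delta(a)=\sum a_{(1)}\otimes a_{(2)}$. Let $A$ and $B$ be regular weak multiplier Hopf algebras. A pairing of $A$ and $B$ is a bilinear form $\langle\cdot,\cdot\rangle:A\times B\to\mathbb{C}$ such that for all $a,a'\in A$, $b,b'\in B$ the multipliers $$a\rhd b=\sum b_{(1)}\langle a,b_{(2)}\rangle,\quad b\lhd a=\sum\langle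 a,b_{(1)}\rangle b_{(2)},\quad b\rhd a=\sum a_{(1)}\langle a_{(2)},b\rangle,\quad a\lhd b=\sum\langle a_{(1)},b\rangle a_{(2)}$$ lie in $B$, $B$, $A$, $A$ respectively; $$\langle a,a'\rhd b\rangle=\langle a',b\lhd a\rangle=\langle aa',b\rangle,\qquad \langle b'\rhd a,b\rangle=\langle a\lhd b,b'\rangle=\langle a,bb'\rangle;$$ the four linear maps $\varphi^l_{A,B}:a\otimes b\mapsto a\rhd b$, $\varphi^r_{A,B}:b\otimes a\mapsto b\lhd a$, $\varphi^l_{B,A}:b\otimes a\mapsto b\rhd a$, $\varphi^r_{B,A}:a\otimes b\mapsto a\lhd b$ are surjective onto $B,B,A,A$; and $\varepsilon_A(a)=\langle a,1\rangle$, $\varepsilon_B(b)=\langle 1,b\rangle$, i.e. $\varepsilon_A(b\rhd a)=\varepsilon_A(a\lhd b)=\langle a,b\rangle=\varepsilon_B(a\rhd b)=\varepsilon_B(b\lhd a)$. An algebra $R$ is a left $A$-module algebra if it is a left $A$-module that is unital ($A\rhd R=R$) and $$a\rhd(xy)=\sum(a_{(1)}\rhd x)(a_{(2)}\rhd y)\qquad(a\in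 A,\ x,y\in R),$$ where the right-hand side is the product applied to $\Delta(a)\rhd(x\otimes y)$: if $x\otimes y=\sum_i (p_i\rhd c_i)\otimes(q_i\rhd d_i)$ with $p_i,q_i\in A$, $c_i,d_i\in R$, then $\Delta(a)\rhd(x\otimes y)=\sum_i(\Delta(a)(p_i\otimes q_i))\rhd(c_i\otimes d_i)$. Right module algebras are defined in the same way, with $(xy)\lhd a=\sum(x\lhd a_{(1)})(y\lhd a_{(2)})$. **Proposition.** For every pairing of regular weak multiplier Hopf algebras $A$ and $B$, the four maps are actions: $(B,\varphi^l_{A,B})$ is a left $A$-module algebra, $(B,\varphi^r_{A,B})$ is a right $A$-module algebra, $(A,\varphi^l_{B,A})$ is a left $B$-module algebra, and $(A,\varphi^r_{B,A})$ is a right $B$-module algebra. -/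

import Mathlib

open scoped TensorProduct

noncomputable section

namespace WMHopf

section Multipliers

variable (A : Type*) [NonUnitalRing A] [Module ℂ A] [IsScalarTower ℂ A A] [SMulCommClass ℂ A A]

/-- The multipliers `M(A)`: pairs `(l, r)` of linear maps `A → A` with `l (ab) = l(a) b`,
`r (ab) = a r(b)` and `r(a) b = a l(b)`; one writes `m a = l(a)` and `a m = r(a)`. -/
@[ext]
structure Multiplier where
  /-- `a ↦ m a` -/
  lmul : A →ₗ[ℂ] A
  /-- `a ↦ a m` -/
  rmul : A →ₗ[ℂ] A
  lmul_mul : ∀ a b, lmul (a * b) = lmul a * b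
  rmul_mul : ∀ a b, rmul (a * b) = a * rmul b
  rmul_mul_eq : ∀ a b, rmul a * b = a * lmul b

namespace Multiplier

variable {A}

instance : Zero (Multiplier A) := ⟨⟨0, 0, by simp, by simp, by simp⟩⟩

instance : Add (Multiplier A) :=
  ⟨fun m n => ⟨m.lmul + n.lmul, m.rmul + n.rmul,
    fun a b => by simp [m.lmul_mul, n.lmul_mul, add_mul],
    fun a b => by simp [m.rmul_mul, n.rmul_mul, mul_add],
    fun a b => by simp [m.rmul_mul_eq, n.rmul_mul_eq, add_mul, mul_add]⟩⟩

instance : Neg (Multiplier A) :=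
  ⟨fun m => ⟨-m.lmul, -m.rmul, fun a b => by simp [m.lmul_mul],
    fun a b => by simp [m.rmul_mul], fun a b => by simp [m.rmul_mul_eq]⟩⟩

instance : SMul ℂ (Multiplier A) :=
  ⟨fun c m => ⟨c • m.lmul, c • m.rmul, fun a b => by simp [m.lmul_mul, smul_mul_assoc],
    fun a b => by simp [m.rmul_mul, mul_smul_comm],
    fun a b => by simp [m.rmul_mul_eq, smul_mul_assoc, mul_smul_comm]⟩⟩

/-- The identity `1` of `M(A)`. -/
instance : One (Multiplier A) :=
  ⟨⟨LinearMap.id, LinearMap.id, by simp, by simp, by simp⟩⟩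

/-- The product of `M(A)`: `(m n) a = m (n a)` and `a (m n) = (a m) n`. -/
instance : Mul (Multiplier A) :=
  ⟨fun m n => ⟨m.lmul ∘ₗ n.lmul, n.rmul ∘ₗ m.rmul,
    fun a b => by simp [m.lmul_mul, n.lmul_mul],
    fun a b => by simp [m.rmul_mul, n.rmul_mul],
    fun a b => by simp [m.rmul_mul_eq, n.rmul_mul_eq]⟩⟩

instance : AddCommGroup (Multiplier A) where
  add_assoc _ _ _ := Multiplier.ext (add_assoc _ _ _) (add_assoc _ _ _)
  zero_add _ := Multiplier.ext (zero_add _) (zero_add _)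
  add_zero _ := Multiplier.ext (add_zero _) (add_zero _)
  add_comm _ _ := Multiplier.ext (add_comm _ _) (add_comm _ _)
  neg_add_cancel _ := Multiplier.ext (neg_add_cancel _) (neg_add_cancel _)
  nsmul := nsmulRec
  zsmul := zsmulRec

instance : Module ℂ (Multiplier A) where
  one_smul _ := Multiplier.ext (one_smul _ _) (one_smul _ _)
  mul_smul _ _ _ := Multiplier.ext (mul_smul _ _ _) (mul_smul _ _ _)
  smul_zero _ := Multiplier.ext (smul_zero _) (smul_zero _)
  smul_add _ _ _ := Multiplier.ext (smul_add _ _ _) (smul_add _ _ _)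
  add_smul _ _ _ := Multiplier.ext (add_smul _ _ _) (add_smul _ _ _)
  zero_smul _ := Multiplier.ext (zero_smul _ _) (zero_smul _ _)

instance : Monoid (Multiplier A) where
  mul_assoc _ _ _ := rfl
  one_mul _ := rfl
  mul_one _ := rfl

end Multiplier

variable {A}

/-- The canonical map `A → M(A)` (an embedding when the product of `A` is non-degenerate). -/
def toMul : A →ₗ[ℂ] Multiplier A where
  toFun a := ⟨LinearMap.mulLeft ℂ a, LinearMap.mulRight ℂ a,
    fun x y => by simp [mul_assoc], fun x y => by simp [mul_assoc],
    fun x y => by simp [mul_assoc]⟩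
  map_add' a b := Multiplier.ext (LinearMap.ext fun x => add_mul a b x)
    (LinearMap.ext fun x => mul_add x a b)
  map_smul' c a := Multiplier.ext (LinearMap.ext fun x => smul_mul_assoc c a x)
    (LinearMap.ext fun x => mul_smul_comm c x a)

variable {B : Type*} [NonUnitalRing B] [Module ℂ B] [IsScalarTower ℂ B B] [SMulCommClass ℂ B B]

/-- The bilinear map `M(A) × M(B) → M(A ⊗ B)`, `(m, n) ↦ m ⊗ n`, which acts factorwise. -/
def tmulMul : Multiplier A →ₗ[ℂ] Multiplier B →ₗ[ℂ] Multiplier (A ⊗[ℂ] B) :=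
  LinearMap.mk₂ ℂ
    (fun m n =>
      { lmul := TensorProduct.map m.lmul n.lmul
        rmul := TensorProduct.map m.rmul n.rmul
        lmul_mul := fun s t => by
          induction s using TensorProduct.induction_on with
          | zero => simp
          | add x y hx hy => simp only [add_mul, map_add, hx, hy]
          | tmul a b =>
            induction t using TensorProduct.induction_on with
            | zero => simp
            | add x y hx hy => simp only [mul_add, map_add, hx, hy]
            | tmul c d => simp [m.lmul_mul, n.lmul_mul]
        rmul_mul := fun s t => by
          induction s using TensorProduct.induction_on with
          | zero => simp
          | add x y hx hy => simp only [add_mul, map_add, hx, hy]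
          | tmul a b =>
            induction t using TensorProduct.induction_on with
            | zero => simp
            | add x y hx hy => simp only [mul_add, map_add, hx, hy]
            | tmul c d => simp [m.rmul_mul, n.rmul_mul]
        rmul_mul_eq := fun s t => by
          induction s using TensorProduct.induction_on with
          | zero => simp
          | add x y hx hy => simp only [add_mul, map_add, hx, hy]
          | tmul a b =>
            induction t using TensorProduct.induction_on with
            | zero => simp
            | add x y hx hy => simp only [mul_add, map_add, hx, hy]
            | tmul c d => simp [m.rmul_mul_eq, n.rmul_mul_eq] })
    (fun _ _ _ => Multiplier.ext (TensorProduct.map_add_left _ _ _)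
      (TensorProduct.map_add_left _ _ _))
    (fun _ _ _ => Multiplier.ext (TensorProduct.map_smul_left _ _ _)
      (TensorProduct.map_smul_left _ _ _))
    (fun _ _ _ => Multiplier.ext (TensorProduct.map_add_right _ _ _)
      (TensorProduct.map_add_right _ _ _))
    (fun _ _ _ => Multiplier.ext (TensorProduct.map_smul_right _ _ _)
      (TensorProduct.map_smul_right _ _ _))

/-- Transport of multipliers along a multiplicative linear isomorphism `e`:
`(conj e m) x = e (m (e⁻¹ x))` and `x (conj e m) = e ((e⁻¹ x) m)`. -/
def conj (e : A ≃ₗ[ℂ] B) (he : ∀ x y, e (x * y) = e x * e y) (m : Multiplier A) :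
    Multiplier B :=
  have he' : ∀ x y, e.symm (x * y) = e.symm x * e.symm y := fun x y => by
    apply e.injective; simp [he]
  { lmul := e.toLinearMap ∘ₗ m.lmul ∘ₗ e.symm.toLinearMap
    rmul := e.toLinearMap ∘ₗ m.rmul ∘ₗ e.symm.toLinearMap
    lmul_mul := fun x y => by simp [he', m.lmul_mul, he]
    rmul_mul := fun x y => by simp [he', m.rmul_mul, he]
    rmul_mul_eq := fun x y => by
      have := congrArg e (m.rmul_mul_eq (e.symm x) (e.symm y))
      simpa [he] using this }

variable (A) in
theorem comm_mul (x y : A ⊗[ℂ] A) :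
    TensorProduct.comm ℂ A A (x * y) = TensorProduct.comm ℂ A A x * TensorProduct.comm ℂ A A y := by
  induction x using TensorProduct.induction_on with
  | zero => simp
  | add x x' hx hx' => simp only [add_mul, map_add, hx, hx']
  | tmul a b =>
    induction y using TensorProduct.induction_on with
    | zero => simp
    | add y y' hy hy' => simp only [mul_add, map_add, hy, hy']
    | tmul c d => simp

variable (A) in
theorem assoc_mul (x y : (A ⊗[ℂ] A) ⊗[ℂ] A) :
    TensorProduct.assoc ℂ A A A (x * y) =
      TensorProduct.assoc ℂ A A A x * TensorProduct.assoc ℂ A A A y := by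
  induction x using TensorProduct.induction_on with
  | zero => simp
  | add x x' hx hx' => simp only [add_mul, map_add, hx, hx']
  | tmul s b =>
    induction y using TensorProduct.induction_on with
    | zero => simp
    | add y y' hy hy' => simp only [mul_add, map_add, hy, hy']
    | tmul t d =>
      induction s using TensorProduct.induction_on with
      | zero => simp
      | add x x' hx hx' => simp only [TensorProduct.add_tmul, add_mul, map_add, hx, hx']
      | tmul a a' =>
        induction t using TensorProduct.induction_on with
        | zero => simp
        | add x x' hx hx' => simp only [TensorProduct.add_tmul, mul_add, map_add, hx, hx']
        | tmul c c' => simp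

/-- The flip on `M(A ⊗ A)`. -/
def flipMul (m : Multiplier (A ⊗[ℂ] A)) : Multiplier (A ⊗[ℂ] A) :=
  conj (TensorProduct.comm ℂ A A) (comm_mul A) m

/-- The identification `M((A ⊗ A) ⊗ A) = M(A ⊗ (A ⊗ A))`. -/
def assocMul (m : Multiplier ((A ⊗[ℂ] A) ⊗[ℂ] A)) : Multiplier (A ⊗[ℂ] (A ⊗[ℂ] A)) :=
  conj (TensorProduct.assoc ℂ A A A) (assoc_mul A) m

/-- `Δ ⊗ ι : A ⊗ A → M(A ⊗ A ⊗ A)`. -/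
def deltaId (Δ : A →ₗ[ℂ] Multiplier (A ⊗[ℂ] A)) (t : A ⊗[ℂ] A) :
    Multiplier (A ⊗[ℂ] (A ⊗[ℂ] A)) :=
  assocMul (TensorProduct.lift
    (tmulMul.compl₁₂ Δ toMul) t)

/-- `ι ⊗ Δ : A ⊗ A → M(A ⊗ A ⊗ A)`. -/
def idDelta (Δ : A →ₗ[ℂ] Multiplier (A ⊗[ℂ] A)) (t : A ⊗[ℂ] A) :
    Multiplier (A ⊗[ℂ] (A ⊗[ℂ] A)) :=
  TensorProduct.lift
    (tmulMul.compl₁₂ toMul Δ) t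

/-- `X` is the value at `m ∈ M(A ⊗ A)` of the extension of `ι ⊗ Δ` to `M(A ⊗ A)`.  This extension
is the homomorphism with `(ι ⊗ Δ)(1) = 1 ⊗ E`; since `(ι ⊗ Δ)(A ⊗ A)` generates the
ideals `(1 ⊗ E)(A ⊗ A ⊗ A)` and `(A ⊗ A ⊗ A)(1 ⊗ E)`, at most one `X` has these properties. -/
def IsIdDeltaExt (Δ : A →ₗ[ℂ] Multiplier (A ⊗[ℂ] A)) (E m : Multiplier (A ⊗[ℂ] A))
    (X : Multiplier (A ⊗[ℂ] (A ⊗[ℂ] A))) : Prop :=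
  tmulMul 1 E * X = X ∧ X * tmulMul 1 E = X ∧
    ∀ t : A ⊗[ℂ] A, X * idDelta Δ t = idDelta Δ (m.lmul t) ∧
      idDelta Δ t * X = idDelta Δ (m.rmul t)

/-- For `T(a ⊗ c) = Δ(a)(1 ⊗ c)` this is `b ⊗ c ↦ Δ₁₃(a)(1 ⊗ b ⊗ c)`, that is
`b ⊗ c ↦ ∑ a₁ ⊗ b ⊗ a₂ c`. -/
def delta13Left (T : A ⊗[ℂ] A →ₗ[ℂ] A ⊗[ℂ] A) (a : A) : A ⊗[ℂ] A →ₗ[ℂ] (A ⊗[ℂ] A) ⊗[ℂ] A :=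
  (TensorProduct.rightComm ℂ A A A).toLinearMap ∘ₗ
    LinearMap.rTensor A (T ∘ₗ TensorProduct.mk ℂ A A a) ∘ₗ
    (TensorProduct.comm ℂ A A).toLinearMap

/-- For `T(a ⊗ c) = (a ⊗ 1)Δ(c)` this is `a ⊗ b ↦ (a ⊗ b ⊗ 1)Δ₁₃(c)`, that is
`a ⊗ b ↦ ∑ a c₁ ⊗ b ⊗ c₂`. -/
def delta13Right (T : A ⊗[ℂ] A →ₗ[ℂ] A ⊗[ℂ] A) (c : A) : A ⊗[ℂ] A →ₗ[ℂ] A ⊗[ℂ] (A ⊗[ℂ] A) :=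
  (TensorProduct.assoc ℂ A A A).toLinearMap ∘ₗ
    (TensorProduct.rightComm ℂ A A A).toLinearMap ∘ₗ
    LinearMap.rTensor A (T ∘ₗ (TensorProduct.mk ℂ A A).flip c)

/-- `f ⊗ ι : A ⊗ A → A` for a linear functional `f`. -/
def funId (f : A →ₗ[ℂ] ℂ) : A ⊗[ℂ] A →ₗ[ℂ] A :=
  (TensorProduct.lid ℂ A).toLinearMap ∘ₗ LinearMap.rTensor A f

/-- `ι ⊗ f : A ⊗ A → A` for a linear functional `f`. -/
def idFun (f : A →ₗ[ℂ] ℂ) : A ⊗[ℂ] A →ₗ[ℂ] A :=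
  (TensorProduct.rid ℂ A).toLinearMap ∘ₗ LinearMap.lTensor A f

end Multipliers

section HopfStructures

/-- A weak multiplier Hopf algebra structure on the algebra `A`.  The maps `T₁`, `T₂`, `ε`, `E`,
`G₁`, `G₂` are determined by the coproduct `Δ`. -/
structure WeakMultiplierHopf (A : Type*) [NonUnitalRing A] [Module ℂ A] [IsScalarTower ℂ A A]
    [SMulCommClass ℂ A A] where
  /-- the product is non-degenerate -/
  nondeg_left : ∀ a : A, (∀ b, a * b = 0) → a = 0
  nondeg_right : ∀ a : A, (∀ b, b * a = 0) → a = 0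
  /-- the algebra is idempotent, `A² = A` -/
  idem : Function.Surjective (LinearMap.mul' ℂ A)
  /-- the coproduct, a homomorphism -/
  Δ : A →ₗ[ℂ] Multiplier (A ⊗[ℂ] A)
  Δ_mul : ∀ a b, Δ (a * b) = Δ a * Δ b
  /-- the canonical map `T₁(a ⊗ b) = Δ(a)(1 ⊗ b)` -/
  T₁ : A ⊗[ℂ] A →ₗ[ℂ] A ⊗[ℂ] A
  T₁_spec : ∀ a b, toMul (T₁ (a ⊗ₜ b)) = Δ a * tmulMul 1 (toMul b)
  /-- the canonical map `T₂(a ⊗ b) = (a ⊗ 1)Δ(b)` -/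
  T₂ : A ⊗[ℂ] A →ₗ[ℂ] A ⊗[ℂ] A
  T₂_spec : ∀ a b, toMul (T₂ (a ⊗ₜ b)) = tmulMul (toMul a) 1 * Δ b
  /-- coassociativity:
  `(c ⊗ 1 ⊗ 1)(Δ ⊗ ι)(Δ(a)(1 ⊗ b)) = (ι ⊗ Δ)((c ⊗ 1)Δ(a))(1 ⊗ 1 ⊗ b)` -/
  coassoc : ∀ a b c,
    tmulMul (toMul c) 1 * deltaId Δ (T₁ (a ⊗ₜ b)) =
      idDelta Δ (T₂ (c ⊗ₜ a)) * tmulMul 1 (tmulMul 1 (toMul b))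
  /-- the coproduct is full -/
  full_left : ∀ V : Submodule ℂ A,
    (∀ t, T₁ t ∈ LinearMap.range (LinearMap.rTensor A V.subtype)) → V = ⊤
  full_right : ∀ W : Submodule ℂ A,
    (∀ t, T₂ t ∈ LinearMap.range (LinearMap.lTensor A W.subtype)) → W = ⊤
  /-- the counit -/
  ε : A →ₗ[ℂ] ℂ
  counit_left : ∀ a b, funId ε (T₁ (a ⊗ₜ b)) = a * b
  counit_right : ∀ a b, idFun ε (T₂ (a ⊗ₜ b)) = a * b
  /-- the canonical idempotent -/
  E : Multiplier (A ⊗[ℂ] A)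
  E_idem : E * E = E
  range_T₁ : LinearMap.range T₁ = LinearMap.range E.lmul
  range_T₂ : LinearMap.range T₂ = LinearMap.range E.rmul
  /-- `(ι ⊗ Δ)E = (E ⊗ 1)(1 ⊗ E) = (1 ⊗ E)(E ⊗ 1)` -/
  idDelta_E : IsIdDeltaExt Δ E E (assocMul (tmulMul E 1) * tmulMul 1 E)
  E_comm : assocMul (tmulMul E 1) * tmulMul 1 E = tmulMul 1 E * assocMul (tmulMul E 1)
  /-- `(G₁ ⊗ ι)(Δ₁₃(a)(1 ⊗ b ⊗ c)) = Δ₁₃(a)(1 ⊗ E)(1 ⊗ b ⊗ c)` -/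
  G₁ : A ⊗[ℂ] A →ₗ[ℂ] A ⊗[ℂ] A
  G₁_spec : ∀ a b c, LinearMap.rTensor A G₁ (delta13Left T₁ a (b ⊗ₜ c)) =
    delta13Left T₁ a (E.lmul (b ⊗ₜ c))
  ker_T₁ : LinearMap.ker T₁ = LinearMap.range (LinearMap.id - G₁)
  /-- `(ι ⊗ G₂)((a ⊗ b ⊗ 1)Δ₁₃(c)) = (a ⊗ b ⊗ 1)(E ⊗ 1)Δ₁₃(c)` -/
  G₂ : A ⊗[ℂ] A →ₗ[ℂ] A ⊗[ℂ] A
  G₂_spec : ∀ a b c, LinearMap.lTensor A G₂ (delta13Right T₂ c (a ⊗ₜ b)) =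
    delta13Right T₂ c (E.rmul (a ⊗ₜ b))
  ker_T₂ : LinearMap.ker T₂ = LinearMap.range (LinearMap.id - G₂)

/-- A regular weak multiplier Hopf algebra: the coproduct is regular and `(A, Δ^cop)` is a weak
multiplier Hopf algebra as well. -/
structure RegularWeakMultiplierHopf (A : Type*) [NonUnitalRing A] [Module ℂ A]
    [IsScalarTower ℂ A A] [SMulCommClass ℂ A A] extends WeakMultiplierHopf A where
  /-- `T₃(a ⊗ b) = (1 ⊗ b)Δ(a)` -/
  T₃ : A ⊗[ℂ] A →ₗ[ℂ] A ⊗[ℂ] A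
  T₃_spec : ∀ a b, toMul (T₃ (a ⊗ₜ b)) = tmulMul 1 (toMul b) * Δ a
  /-- `T₄(a ⊗ b) = Δ(b)(a ⊗ 1)` -/
  T₄ : A ⊗[ℂ] A →ₗ[ℂ] A ⊗[ℂ] A
  T₄_spec : ∀ a b, toMul (T₄ (a ⊗ₜ b)) = Δ b * tmulMul (toMul a) 1
  /-- the weak multiplier Hopf algebra `(A, Δ^cop)` -/
  cop : WeakMultiplierHopf A
  cop_Δ : ∀ a, cop.Δ a = flipMul (Δ a)

end HopfStructures

section ModuleAlgebras

variable {C V : Type*} [NonUnitalRing C] [Module ℂ C] [IsScalarTower ℂ C C]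
  [SMulCommClass ℂ C C] [AddCommGroup V] [Module ℂ V]

/-- For a unital left `C`-module `V`, the extended action of `m ∈ M(C)` sends `v` to `v'`:
`v = ∑ cᵢ vᵢ` and `v' = ∑ (m cᵢ) vᵢ`. -/
def LeftMulActs (act : C →ₗ[ℂ] V →ₗ[ℂ] V) (m : Multiplier C) (v v' : V) : Prop :=
  ∃ w : C ⊗[ℂ] V, TensorProduct.lift act w = v ∧
    TensorProduct.lift act (LinearMap.rTensor V m.lmul w) = v'

/-- For a unital right `C`-module `V`, the extended action of `m ∈ M(C)` sends `v` to `v'`: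
`v = ∑ vᵢ cᵢ` and `v' = ∑ vᵢ (cᵢ m)`. -/
def RightMulActs (act : V →ₗ[ℂ] C →ₗ[ℂ] V) (m : Multiplier C) (v v' : V) : Prop :=
  ∃ w : V ⊗[ℂ] C, TensorProduct.lift act w = v ∧
    TensorProduct.lift act (LinearMap.lTensor V m.rmul w) = v'

variable {A R : Type*} [NonUnitalRing A] [Module ℂ A] [IsScalarTower ℂ A A]
  [SMulCommClass ℂ A A] [NonUnitalRing R] [Module ℂ R] [IsScalarTower ℂ R R]
  [SMulCommClass ℂ R R]

/-- `act` (written `a ▷ x`) makes the algebra `R` a left `A`-module algebra: `R` is a unital left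
`A`-module and `a ▷ (xy) = mul (Δ(a) ▷ (x ⊗ y)) = ∑ (a₁ ▷ x)(a₂ ▷ y)`, where `M(A ⊗ A)` acts on
`R ⊗ R` by extension of the factorwise action of `A ⊗ A`. -/
structure IsLeftModuleAlgebra (H : WeakMultiplierHopf A) (act : A →ₗ[ℂ] R →ₗ[ℂ] R) : Prop where
  mul_act : ∀ a b x, act (a * b) x = act a (act b x)
  unital : Function.Surjective (TensorProduct.lift act)
  act_mul : ∀ a x y s, LeftMulActs (TensorProduct.map₂ act act) (H.Δ a) (x ⊗ₜ[ℂ] y) s →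
    act a (x * y) = LinearMap.mul' ℂ R s

/-- `act` (written `x ◁ a`) makes the algebra `R` a right `A`-module algebra: `R` is a unital right
`A`-module and `(xy) ◁ a = mul ((x ⊗ y) ◁ Δ(a)) = ∑ (x ◁ a₁)(y ◁ a₂)`. -/
structure IsRightModuleAlgebra (H : WeakMultiplierHopf A) (act : R →ₗ[ℂ] A →ₗ[ℂ] R) : Prop where
  act_mul : ∀ a b x, act x (a * b) = act (act x a) b
  unital : Function.Surjective (TensorProduct.lift act)
  mul_act : ∀ a x y s, RightMulActs (TensorProduct.map₂ act act) (H.Δ a) (x ⊗ₜ[ℂ] y) s →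
    act (x * y) a = LinearMap.mul' ℂ R s

end ModuleAlgebras

section Pairings

theorem funId_add {A : Type*} [NonUnitalRing A] [Module ℂ A] (f g : A →ₗ[ℂ] ℂ) (t : A ⊗[ℂ] A) :
    funId (f + g) t = funId f t + funId g t := by
  simp [funId, LinearMap.rTensor_add]

theorem funId_smul {A : Type*} [NonUnitalRing A] [Module ℂ A] (k : ℂ) (f : A →ₗ[ℂ] ℂ) (t : A ⊗[ℂ] A) :
    funId (k • f) t = k • funId f t := by
  simp [funId, LinearMap.rTensor_smul]

theorem idFun_add {A : Type*} [NonUnitalRing A] [Module ℂ A] (f g : A →ₗ[ℂ] ℂ) (t : A ⊗[ℂ] A) :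
    idFun (f + g) t = idFun f t + idFun g t := by
  simp [idFun, LinearMap.lTensor_add]

theorem idFun_smul {A : Type*} [NonUnitalRing A] [Module ℂ A] (k : ℂ) (f : A →ₗ[ℂ] ℂ) (t : A ⊗[ℂ] A) :
    idFun (k • f) t = k • idFun f t := by
  simp [idFun, LinearMap.lTensor_smul]

variable {A B : Type*} [NonUnitalRing A] [Module ℂ A] [IsScalarTower ℂ A A] [SMulCommClass ℂ A A]
  [NonUnitalRing B] [Module ℂ B] [IsScalarTower ℂ B B] [SMulCommClass ℂ B B]

/-- The multiplier `(f ⊗ ι)Δ(a)` of `A` is the element `z` of `A`: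
`z c = (f ⊗ ι)(Δ(a)(1 ⊗ c))` and `c z = (f ⊗ ι)((1 ⊗ c)Δ(a))`. -/
def RegularWeakMultiplierHopf.IsFunId (H : RegularWeakMultiplierHopf A) (f : A →ₗ[ℂ] ℂ)
    (a z : A) : Prop :=
  ∀ c, z * c = funId f (H.T₁ (a ⊗ₜ c)) ∧ c * z = funId f (H.T₃ (a ⊗ₜ c))

/-- The multiplier `(ι ⊗ f)Δ(a)` of `A` is the element `z` of `A`:
`z c = (ι ⊗ f)(Δ(a)(c ⊗ 1))` and `c z = (ι ⊗ f)((c ⊗ 1)Δ(a))`. -/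
def RegularWeakMultiplierHopf.IsIdFun (H : RegularWeakMultiplierHopf A) (f : A →ₗ[ℂ] ℂ)
    (a z : A) : Prop :=
  ∀ c, z * c = idFun f (H.T₄ (c ⊗ₜ a)) ∧ c * z = idFun f (H.T₂ (c ⊗ₜ a))

theorem eq_of_mul_right (H : RegularWeakMultiplierHopf A) {z w : A} (h : ∀ c, z * c = w * c) :
    z = w :=
  sub_eq_zero.1 (H.nondeg_left _ fun c => by rw [sub_mul, h, sub_self])

/-- If all the multipliers `(F x ⊗ ι)Δ(a)` lie in `A`, this is the bilinear map sending `(x, a)` to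
that element. -/
def funIdMap (H : RegularWeakMultiplierHopf A) {X : Type*} [AddCommGroup X] [Module ℂ X]
    (F : X →ₗ[ℂ] A →ₗ[ℂ] ℂ) (h : ∀ x a, ∃ z, H.IsFunId (F x) a z) : X →ₗ[ℂ] A →ₗ[ℂ] A :=
  LinearMap.mk₂ ℂ (fun x a => (h x a).choose)
    (fun x x' a => eq_of_mul_right H fun c => by
      rw [add_mul, ((h _ _).choose_spec c).1, ((h _ _).choose_spec c).1,
        ((h _ _).choose_spec c).1, map_add, funId_add])
    (fun k x a => eq_of_mul_right H fun c => by
      rw [smul_mul_assoc, ((h _ _).choose_spec c).1, ((h _ _).choose_spec c).1, map_smul,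
        funId_smul])
    (fun x a a' => eq_of_mul_right H fun c => by
      rw [add_mul, ((h _ _).choose_spec c).1, ((h _ _).choose_spec c).1,
        ((h _ _).choose_spec c).1, TensorProduct.add_tmul, map_add, map_add])
    (fun k x a => eq_of_mul_right H fun c => by
      rw [smul_mul_assoc, ((h _ _).choose_spec c).1, ((h _ _).choose_spec c).1,
        ← TensorProduct.smul_tmul', map_smul, map_smul])

/-- If all the multipliers `(ι ⊗ F x)Δ(a)` lie in `A`, this is the bilinear map sending `(x, a)` to
that element. -/
def idFunMap (H : RegularWeakMultiplierHopf A) {X : Type*} [AddCommGroup X] [Module ℂ X]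
    (F : X →ₗ[ℂ] A →ₗ[ℂ] ℂ) (h : ∀ x a, ∃ z, H.IsIdFun (F x) a z) : X →ₗ[ℂ] A →ₗ[ℂ] A :=
  LinearMap.mk₂ ℂ (fun x a => (h x a).choose)
    (fun x x' a => eq_of_mul_right H fun c => by
      rw [add_mul, ((h _ _).choose_spec c).1, ((h _ _).choose_spec c).1,
        ((h _ _).choose_spec c).1, map_add, idFun_add])
    (fun k x a => eq_of_mul_right H fun c => by
      rw [smul_mul_assoc, ((h _ _).choose_spec c).1, ((h _ _).choose_spec c).1, map_smul,
        idFun_smul])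
    (fun x a a' => eq_of_mul_right H fun c => by
      rw [add_mul, ((h _ _).choose_spec c).1, ((h _ _).choose_spec c).1,
        ((h _ _).choose_spec c).1, TensorProduct.tmul_add, map_add, map_add])
    (fun k x a => eq_of_mul_right H fun c => by
      rw [smul_mul_assoc, ((h _ _).choose_spec c).1, ((h _ _).choose_spec c).1,
        TensorProduct.tmul_smul, map_smul, map_smul])

/-- A bilinear form on `A × B` all of whose slices of the coproducts are elements of the algebras:
`(⟨a, ·⟩ ⊗ ι)Δ(b)`, `(ι ⊗ ⟨a, ·⟩)Δ(b)` lie in `B` and `(⟨·, b⟩ ⊗ ι)Δ(a)`, `(ι ⊗ ⟨·, b⟩)Δ(a)` lie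
in `A`. -/
structure SliceForm (HA : RegularWeakMultiplierHopf A) (HB : RegularWeakMultiplierHopf B) where
  /-- `form a b = ⟨a, b⟩` -/
  form : A →ₗ[ℂ] B →ₗ[ℂ] ℂ
  funId_B : ∀ a b, ∃ z, HB.IsFunId (form a) b z
  idFun_B : ∀ a b, ∃ z, HB.IsIdFun (form a) b z
  funId_A : ∀ b a, ∃ z, HA.IsFunId (form.flip b) a z
  idFun_A : ∀ b a, ∃ z, HA.IsIdFun (form.flip b) a z

variable {HA : RegularWeakMultiplierHopf A} {HB : RegularWeakMultiplierHopf B}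

/-- `φˡ_{A,B} : a ⊗ b ↦ a ▷ b = (ι ⊗ ⟨a, ·⟩)Δ(b) = ∑ ⟨a, b₂⟩ b₁`. -/
def SliceForm.leftAB (P : SliceForm HA HB) : A →ₗ[ℂ] B →ₗ[ℂ] B :=
  idFunMap HB P.form P.idFun_B

/-- `φʳ_{A,B} : b ⊗ a ↦ b ◁ a = (⟨a, ·⟩ ⊗ ι)Δ(b) = ∑ ⟨a, b₁⟩ b₂`. -/
def SliceForm.rightAB (P : SliceForm HA HB) : B →ₗ[ℂ] A →ₗ[ℂ] B :=
  (funIdMap HB P.form P.funId_B).flip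

/-- `φˡ_{B,A} : b ⊗ a ↦ b ▷ a = (ι ⊗ ⟨·, b⟩)Δ(a) = ∑ a₁ ⟨a₂, b⟩`. -/
def SliceForm.leftBA (P : SliceForm HA HB) : B →ₗ[ℂ] A →ₗ[ℂ] A :=
  idFunMap HA P.form.flip P.idFun_A

/-- `φʳ_{B,A} : a ⊗ b ↦ a ◁ b = (⟨·, b⟩ ⊗ ι)Δ(a) = ∑ a₂ ⟨a₁, b⟩`. -/
def SliceForm.rightBA (P : SliceForm HA HB) : A →ₗ[ℂ] B →ₗ[ℂ] A :=
  (funIdMap HA P.form.flip P.funId_A).flip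

/-- A pre-pairing of two regular weak multiplier Hopf algebras. -/
structure PrePairing (HA : RegularWeakMultiplierHopf A) (HB : RegularWeakMultiplierHopf B)
    extends SliceForm HA HB where
  form_leftAB : ∀ a a' b, form a (toSliceForm.leftAB a' b) = form (a * a') b
  form_rightAB : ∀ a a' b, form a' (toSliceForm.rightAB b a) = form (a * a') b
  form_leftBA : ∀ a b b', form (toSliceForm.leftBA b' a) b = form a (b * b')
  form_rightBA : ∀ a b b', form (toSliceForm.rightBA a b) b' = form a (b * b')

/-- A pairing: the four maps are surjective, and `ε_A(a) = ⟨a, 1⟩`, `ε_B(b) = ⟨1, b⟩`.  The numbers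
`⟨a, 1⟩` and `⟨1, b⟩` come from the extension of the pairing to multipliers, so they are given by
`⟨b ▷ a, 1⟩ = ⟨a, b⟩ = ⟨a ◁ b, 1⟩` and `⟨1, a ▷ b⟩ = ⟨a, b⟩ = ⟨1, b ◁ a⟩`. -/
structure Pairing (HA : RegularWeakMultiplierHopf A) (HB : RegularWeakMultiplierHopf B)
    extends PrePairing HA HB where
  surj_leftAB : Function.Surjective (TensorProduct.lift toSliceForm.leftAB)
  surj_rightAB : Function.Surjective (TensorProduct.lift toSliceForm.rightAB)
  surj_leftBA : Function.Surjective (TensorProduct.lift toSliceForm.leftBA)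
  surj_rightBA : Function.Surjective (TensorProduct.lift toSliceForm.rightBA)
  counit_leftBA : ∀ a b, HA.ε (toSliceForm.leftBA b a) = form a b
  counit_rightBA : ∀ a b, HA.ε (toSliceForm.rightBA a b) = form a b
  counit_leftAB : ∀ a b, HB.ε (toSliceForm.leftAB a b) = form a b
  counit_rightAB : ∀ a b, HB.ε (toSliceForm.rightAB b a) = form a b

end Pairings

end WMHopf

end

open scoped TensorProduct

noncomputable section

namespace WMHopf

/-! ### Arithmetic of multipliers -/

section MultiplierLemmas

variable {A B : Type*} [NonUnitalRing A] [Module ℂ A] [NonUnitalRing B] [Module ℂ B]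

/-! On paper both axioms are short Sweedler computations. Coassociativity gives Δ(a ▷ b) = ∑ b₁ ⊗ (a
▷ b₂); slicing by a functional then turns ⟨a, a' ▷ x⟩ = ⟨aa', x⟩ into the module law.
Multiplicativity of Δ together with ⟨a, xy⟩ = ⟨Δ(a), x ⊗ y⟩ gives the product rule. The work lies in
covering: Δ takes values in multipliers, while coassociativity is only given for elements covered on
both sides.

The covering comes from the pairing. An element a is a sum of elements b' ▷ a', because φˡ_{B,A} is
surjective, and ⟨b' ▷ a', x⟩ = ⟨a', xb'⟩. Hence (b' ▷ a') ▷ b = (ι ⊗ ⟨a', ·⟩)(Δ(b)(1 ⊗ b')), a slice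
of an honest element of B ⊗ B, to which coassociativity applies (`T₂_leftAB`). The right action is
covered in the same way by φʳ_{B,A} (`T₁_rightAB`).

Since the form may be degenerate, elements of B are not compared by pairing them with A. They are
compared after multiplication by an arbitrary element, on the left for ▷ and on the right for ◁,
using that the product of B is non-degenerate. The scalar product rules `form_leftAB_mul_leftAB` and
`form_rightAB_mul_rightAB` are thereby lifted to identities in B (`leftAB_act_mul`,
`rightAB_act_mul`). The two actions on A follow by exchanging the roles of A and B. -/

theorem Multiplier.mul_add' (m n n' : Multiplier A) : m * (n + n') = m * n + m * n' :=
  Multiplier.ext (LinearMap.ext fun _ => map_add m.lmul _ _) rfl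

theorem Multiplier.add_mul' (m n n' : Multiplier A) : (n + n') * m = n * m + n' * m :=
  Multiplier.ext rfl (LinearMap.ext fun _ => map_add m.rmul _ _)

theorem Multiplier.mul_zero' (m : Multiplier A) : m * 0 = 0 :=
  Multiplier.ext (LinearMap.ext fun _ => map_zero m.lmul) rfl

theorem Multiplier.zero_mul' (m : Multiplier A) : 0 * m = 0 :=
  Multiplier.ext rfl (LinearMap.ext fun _ => map_zero m.rmul)

theorem conj_mul (e : A ≃ₗ[ℂ] B) (he : ∀ x y, e (x * y) = e x * e y) (m n : Multiplier A) :
    conj e he (m * n) = conj e he m * conj e he n := by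
  apply Multiplier.ext
  · ext x
    change e (m.lmul (n.lmul (e.symm x))) = e (m.lmul (e.symm (e (n.lmul (e.symm x)))))
    simp
  · ext x
    change e (n.rmul (m.rmul (e.symm x))) = e (n.rmul (e.symm (e (m.rmul (e.symm x)))))
    simp

end MultiplierLemmas

/-! ### Non-degeneracy of tensor products, and elements as multipliers -/

section Tensor

variable {A B : Type*} [NonUnitalRing A] [Module ℂ A] [IsScalarTower ℂ A A] [SMulCommClass ℂ A A]
  [NonUnitalRing B] [Module ℂ B] [IsScalarTower ℂ B B] [SMulCommClass ℂ B B]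

/-- In a basis of V a tensor is a finitely supported family of coefficients in U, and `f x ⊗ ι` acts
on each coefficient separately. -/
theorem eq_zero_of_rTensor {U V X : Type*} [AddCommGroup U] [Module ℂ U] [AddCommGroup V]
    [Module ℂ V] (f : X → U →ₗ[ℂ] U) (hf : ∀ u, (∀ x, f x u = 0) → u = 0) (t : U ⊗[ℂ] V)
    (ht : ∀ x, LinearMap.rTensor V (f x) t = 0) : t = 0 := by
  classical
  let b := Module.Basis.ofVectorSpace ℂ V
  let e := TensorProduct.equivFinsuppOfBasisRight (M := U) b
  have key : ∀ x (s : U ⊗[ℂ] V) i, e (LinearMap.rTensor V (f x) s) i = f x (e s i) := by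
    intro x s i
    induction s using TensorProduct.induction_on with
    | zero => simp
    | add s s' hs hs' => simp only [map_add, Finsupp.add_apply, hs, hs']
    | tmul u v => simp [e]
  apply e.injective
  rw [map_zero]
  ext i
  refine hf _ fun x => ?_
  rw [← key, ht]
  simp

theorem eq_zero_of_lTensor {U V X : Type*} [AddCommGroup U] [Module ℂ U] [AddCommGroup V]
    [Module ℂ V] (f : X → V →ₗ[ℂ] V) (hf : ∀ v, (∀ x, f x v = 0) → v = 0) (t : U ⊗[ℂ] V)
    (ht : ∀ x, LinearMap.lTensor U (f x) t = 0) : t = 0 := by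
  apply (TensorProduct.comm ℂ U V).injective
  rw [map_zero]
  refine eq_zero_of_rTensor f hf _ fun x => ?_
  have h := LinearMap.comm_comp_lTensor_comp_comm_eq (Q := U) (g := f x)
  rw [← h]
  simp [ht]

/-- The product of a tensor product of algebras with non-degenerate product is non-degenerate. -/
theorem tensor_nondeg_left (hA : ∀ a : A, (∀ b, a * b = 0) → a = 0)
    (hB : ∀ a : B, (∀ b, a * b = 0) → a = 0) (t : A ⊗[ℂ] B) (ht : ∀ s, t * s = 0) : t = 0 := by
  -- Right multiplication by a ⊗ b acts leg by leg, so the legs are stripped one at a time.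
  refine eq_zero_of_rTensor (LinearMap.mulRight ℂ) hA t fun a => ?_
  refine eq_zero_of_lTensor (LinearMap.mulRight ℂ) hB _ fun b => ?_
  rw [← ht (a ⊗ₜ b)]
  clear ht
  induction t using TensorProduct.induction_on with
  | zero => simp
  | add x y hx hy => simp only [map_add, add_mul, hx, hy]
  | tmul x y => simp

/-- This allows identities between elements to be checked among multipliers, where Δ(a) is itself
available as a factor and associativity does the rest. -/
theorem toMul_injective (hA : ∀ a : A, (∀ b, a * b = 0) → a = 0) :
    Function.Injective (toMul : A →ₗ[ℂ] Multiplier A) := by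
  intro a b h
  refine sub_eq_zero.1 (hA _ fun c => ?_)
  have := LinearMap.congr_fun (congrArg Multiplier.lmul h) c
  simpa [toMul, sub_mul, sub_eq_zero] using this

theorem toMul_lmul (m : Multiplier A) (a : A) : toMul (m.lmul a) = m * toMul a :=
  Multiplier.ext (LinearMap.ext fun x => (m.lmul_mul a x).symm)
    (LinearMap.ext fun x => (m.rmul_mul_eq x a).symm)

theorem toMul_rmul (m : Multiplier A) (a : A) : toMul (m.rmul a) = toMul a * m :=
  Multiplier.ext (LinearMap.ext fun x => m.rmul_mul_eq a x)
    (LinearMap.ext fun x => (m.rmul_mul x a).symm)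

theorem tmulMul_mul (m m' : Multiplier A) (n n' : Multiplier B) :
    tmulMul (m * m') (n * n') = tmulMul m n * tmulMul m' n' :=
  Multiplier.ext (TensorProduct.map_comp _ _ _ _) (TensorProduct.map_comp _ _ _ _)

theorem toMul_tmul (a : A) (b : B) : toMul (a ⊗ₜ[ℂ] b) = tmulMul (toMul a) (toMul b) :=
  Multiplier.ext (TensorProduct.ext' fun x y => Algebra.TensorProduct.tmul_mul_tmul a x b y)
    (TensorProduct.ext' fun x y => Algebra.TensorProduct.tmul_mul_tmul x a y b)

theorem conj_toMul (e : A ≃ₗ[ℂ] B) (he : ∀ x y, e (x * y) = e x * e y) (a : A) :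
    conj e he (toMul a) = toMul (e a) := by
  apply Multiplier.ext
  · ext x
    change e (a * e.symm x) = e a * x
    simp [he]
  · ext x
    change e (e.symm x * a) = x * e a
    simp [he]

theorem assocMul_tmulMul (m n k : Multiplier A) :
    assocMul (tmulMul (tmulMul m n) k) = tmulMul m (tmulMul n k) :=
  Multiplier.ext (TensorProduct.ext <| LinearMap.ext fun _ => TensorProduct.ext' fun _ _ => rfl)
    (TensorProduct.ext <| LinearMap.ext fun _ => TensorProduct.ext' fun _ _ => rfl)

theorem tmulMul_one_one : tmulMul (1 : Multiplier A) (1 : Multiplier B) = 1 :=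
  Multiplier.ext TensorProduct.map_id TensorProduct.map_id

theorem toMul_rTensor_mulLeft (c : A) (t : A ⊗[ℂ] B) :
    toMul (LinearMap.rTensor B (LinearMap.mulLeft ℂ c) t) = tmulMul (toMul c) 1 * toMul t := by
  rw [← toMul_lmul]; rfl

theorem toMul_rTensor_mulRight (c : A) (t : A ⊗[ℂ] B) :
    toMul (LinearMap.rTensor B (LinearMap.mulRight ℂ c) t) = toMul t * tmulMul (toMul c) 1 := by
  rw [← toMul_rmul]; rfl

theorem toMul_lTensor_mulLeft (c : B) (t : A ⊗[ℂ] B) :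
    toMul (LinearMap.lTensor A (LinearMap.mulLeft ℂ c) t) = tmulMul 1 (toMul c) * toMul t := by
  rw [← toMul_lmul]; rfl

theorem toMul_lTensor_mulRight (c : B) (t : A ⊗[ℂ] B) :
    toMul (LinearMap.lTensor A (LinearMap.mulRight ℂ c) t) = toMul t * tmulMul 1 (toMul c) := by
  rw [← toMul_rmul]; rfl

end Tensor

/-! ### Slicing a leg by a functional -/

section Slices

variable {A : Type*} [NonUnitalRing A] [Module ℂ A]

@[simp]
theorem funId_tmul (f : A →ₗ[ℂ] ℂ) (a b : A) : funId f (a ⊗ₜ b) = f a • b := by simp [funId]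

@[simp]
theorem idFun_tmul (f : A →ₗ[ℂ] ℂ) (a b : A) : idFun f (a ⊗ₜ b) = f b • a := by simp [idFun]

theorem funId_rTensor (f g : A →ₗ[ℂ] ℂ) (h : A →ₗ[ℂ] A) (H : ∀ x, f (h x) = g x) (t : A ⊗[ℂ] A) :
    funId f (LinearMap.rTensor A h t) = funId g t := by
  induction t using TensorProduct.induction_on with
  | zero => simp
  | add x y hx hy => simp only [map_add, hx, hy]
  | tmul x y => simp [H]

theorem idFun_lTensor (f g : A →ₗ[ℂ] ℂ) (h : A →ₗ[ℂ] A) (H : ∀ x, f (h x) = g x) (t : A ⊗[ℂ] A) :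
    idFun f (LinearMap.lTensor A h t) = idFun g t := by
  induction t using TensorProduct.induction_on with
  | zero => simp
  | add x y hx hy => simp only [map_add, hx, hy]
  | tmul x y => simp [H]

theorem funId_lTensor (f : A →ₗ[ℂ] ℂ) (h : A →ₗ[ℂ] A) (t : A ⊗[ℂ] A) :
    funId f (LinearMap.lTensor A h t) = h (funId f t) := by
  induction t using TensorProduct.induction_on with
  | zero => simp
  | add x y hx hy => simp only [map_add, hx, hy]
  | tmul x y => simp

theorem idFun_rTensor (f : A →ₗ[ℂ] ℂ) (h : A →ₗ[ℂ] A) (t : A ⊗[ℂ] A) :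
    idFun f (LinearMap.rTensor A h t) = h (idFun f t) := by
  induction t using TensorProduct.induction_on with
  | zero => simp
  | add x y hx hy => simp only [map_add, hx, hy]
  | tmul x y => simp

end Slices

/-! ### Canonical maps and coassociativity -/

namespace WeakMultiplierHopf

variable {A : Type*} [NonUnitalRing A] [Module ℂ A] [IsScalarTower ℂ A A] [SMulCommClass ℂ A A]
  (H : WeakMultiplierHopf A)

theorem eq_of_mul_left (H : WeakMultiplierHopf A) {z w : A} (h : ∀ c, c * z = c * w) : z = w :=
  sub_eq_zero.1 (H.nondeg_right _ fun c => by rw [mul_sub, h, sub_self])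

theorem toMul_injective₂ (H : WeakMultiplierHopf A) :
    Function.Injective (toMul (A := A ⊗[ℂ] A)) :=
  toMul_injective (tensor_nondeg_left H.nondeg_left H.nondeg_left)

theorem toMul_injective₃ (H : WeakMultiplierHopf A) :
    Function.Injective (toMul (A := A ⊗[ℂ] (A ⊗[ℂ] A))) :=
  toMul_injective
    (tensor_nondeg_left H.nondeg_left (tensor_nondeg_left H.nondeg_left H.nondeg_left))

/-- `(c ⊗ 1)(Δ(a)(1 ⊗ b)) = ((c ⊗ 1)Δ(a))(1 ⊗ b)`. -/
theorem rTensor_mulLeft_T₁ (a b c : A) :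
    LinearMap.rTensor A (LinearMap.mulLeft ℂ c) (H.T₁ (a ⊗ₜ b)) =
      LinearMap.lTensor A (LinearMap.mulRight ℂ b) (H.T₂ (c ⊗ₜ a)) := by
  apply H.toMul_injective₂
  rw [toMul_rTensor_mulLeft, toMul_lTensor_mulRight, H.T₁_spec, H.T₂_spec, mul_assoc]

theorem T₁_mul (x y c : A) : H.T₁ ((x * y) ⊗ₜ c) = (H.Δ x).lmul (H.T₁ (y ⊗ₜ c)) := by
  apply H.toMul_injective₂
  rw [toMul_lmul, H.T₁_spec, H.T₁_spec, H.Δ_mul, mul_assoc]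

theorem T₂_mul (c x y : A) : H.T₂ (c ⊗ₜ (x * y)) = (H.Δ y).rmul (H.T₂ (c ⊗ₜ x)) := by
  apply H.toMul_injective₂
  rw [toMul_rmul, H.T₂_spec, H.T₂_spec, H.Δ_mul, mul_assoc]

/-- `Δ(x)(h ⊗ f) = (Δ(x)(1 ⊗ f))(h ⊗ 1)`. -/
theorem Δ_lmul_tmul (x h f : A) : (H.Δ x).lmul (h ⊗ₜ f) =
    LinearMap.rTensor A (LinearMap.mulRight ℂ h) (H.T₁ (x ⊗ₜ f)) := by
  apply H.toMul_injective₂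
  rw [toMul_lmul, toMul_rTensor_mulRight, H.T₁_spec, toMul_tmul, mul_assoc, ← tmulMul_mul, one_mul,
    mul_one]

/-- `(f ⊗ h)Δ(x) = (1 ⊗ h)((f ⊗ 1)Δ(x))`. -/
theorem Δ_rmul_tmul (x f h : A) : (H.Δ x).rmul (f ⊗ₜ h) =
    LinearMap.lTensor A (LinearMap.mulLeft ℂ h) (H.T₂ (f ⊗ₜ x)) := by
  apply H.toMul_injective₂
  rw [toMul_rmul, toMul_lTensor_mulLeft, H.T₂_spec, toMul_tmul, ← mul_assoc, ← tmulMul_mul, one_mul,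
    mul_one]

theorem toMul_rTensor_T₂ (c : A) (t : A ⊗[ℂ] A) :
    toMul (TensorProduct.assoc ℂ A A A
      (LinearMap.rTensor A (H.T₂ ∘ₗ TensorProduct.mk ℂ A A c) t)) =
      tmulMul (toMul c) 1 * deltaId H.Δ t := by
  induction t using TensorProduct.induction_on with
  | zero =>
    have : deltaId H.Δ 0 = 0 := by
      rw [deltaId, map_zero]
      exact Multiplier.ext (LinearMap.ext fun x => map_zero (TensorProduct.assoc ℂ A A A))
        (LinearMap.ext fun x => map_zero (TensorProduct.assoc ℂ A A A))
    rw [this, Multiplier.mul_zero', map_zero, map_zero, map_zero]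
  | add x y hx hy =>
    have : deltaId H.Δ (x + y) = deltaId H.Δ x + deltaId H.Δ y := by
      rw [deltaId, map_add]
      exact Multiplier.ext (LinearMap.ext fun x => map_add (TensorProduct.assoc ℂ A A A) _ _)
        (LinearMap.ext fun x => map_add (TensorProduct.assoc ℂ A A A) _ _)
    rw [this, Multiplier.mul_add', map_add, map_add, map_add, hx, hy]
  | tmul a b =>
    have h1 : deltaId H.Δ (a ⊗ₜ b) = assocMul (tmulMul (H.Δ a) (toMul b)) := rfl
    -- Writing b as 1 · b splits (c ⊗ 1)Δ(a) ⊗ b into the product of (c ⊗ 1) ⊗ 1 and Δ(a) ⊗ b, and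
    -- reassociation respects products.
    rw [h1, ← conj_toMul (A := (A ⊗[ℂ] A) ⊗[ℂ] A) (B := A ⊗[ℂ] (A ⊗[ℂ] A)) (TensorProduct.assoc ℂ A A A)
        (assoc_mul A), LinearMap.rTensor_tmul,
      LinearMap.comp_apply, TensorProduct.mk_apply, toMul_tmul, H.T₂_spec,
      ← one_mul (toMul b), tmulMul_mul, conj_mul]
    change assocMul _ * assocMul _ = _
    rw [assocMul_tmulMul, tmulMul_one_one, one_mul]

theorem toMul_lTensor_T₁ (b : A) (t : A ⊗[ℂ] A) :
    toMul (LinearMap.lTensor A (H.T₁ ∘ₗ (TensorProduct.mk ℂ A A).flip b) t) =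
      idDelta H.Δ t * tmulMul 1 (tmulMul 1 (toMul b)) := by
  induction t using TensorProduct.induction_on with
  | zero => rw [idDelta, map_zero, map_zero, map_zero, Multiplier.zero_mul']
  | add x y hx hy =>
    have : idDelta H.Δ (x + y) = idDelta H.Δ x + idDelta H.Δ y := by
      simp only [idDelta, map_add]
    rw [this, Multiplier.add_mul', map_add, map_add, hx, hy]
  | tmul c a =>
    have h1 : idDelta H.Δ (c ⊗ₜ a) = tmulMul (toMul c) (H.Δ a) := rfl
    rw [h1, LinearMap.lTensor_tmul, toMul_tmul, ← tmulMul_mul, mul_one, LinearMap.comp_apply,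
      LinearMap.flip_apply, TensorProduct.mk_apply, H.T₁_spec]

/-- Coassociativity in terms of the canonical maps. -/
theorem T₂_T₁ (a b c : A) :
    TensorProduct.assoc ℂ A A A
      (LinearMap.rTensor A (H.T₂ ∘ₗ TensorProduct.mk ℂ A A c) (H.T₁ (a ⊗ₜ b))) =
    LinearMap.lTensor A (H.T₁ ∘ₗ (TensorProduct.mk ℂ A A).flip b) (H.T₂ (c ⊗ₜ a)) := by
  apply H.toMul_injective₃
  rw [toMul_rTensor_T₂, toMul_lTensor_T₁, H.coassoc]

/-- `(c ⊗ 1)Δ((ι ⊗ f)(Δ(a)(1 ⊗ b)))` is obtained by applying `x ↦ (ι ⊗ f)(Δ(x)(1 ⊗ b))` to the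
second leg of `(c ⊗ 1)Δ(a)`. -/
theorem T₂_idFun_T₁ (f : A →ₗ[ℂ] ℂ) (a b c : A) :
    H.T₂ (c ⊗ₜ idFun f (H.T₁ (a ⊗ₜ b))) =
      LinearMap.lTensor A (idFun f ∘ₗ H.T₁ ∘ₗ (TensorProduct.mk ℂ A A).flip b)
        (H.T₂ (c ⊗ₜ a)) := by
  -- Slice the third leg of coassociativity; what remains is linear in Δ(a)(1 ⊗ b).
  have h := congrArg (LinearMap.lTensor A (idFun f)) (H.T₂_T₁ a b c)
  rw [← LinearMap.lTensor_comp_apply] at h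
  rw [← h]
  generalize H.T₁ (a ⊗ₜ b) = t
  induction t using TensorProduct.induction_on with
  | zero => simp
  | add x y hx hy => simp only [map_add, TensorProduct.tmul_add, hx, hy]
  | tmul x y =>
    simp only [idFun_tmul, TensorProduct.tmul_smul, map_smul, LinearMap.rTensor_tmul,
      LinearMap.comp_apply, TensorProduct.mk_apply]
    generalize H.T₂ (c ⊗ₜ x) = s
    induction s using TensorProduct.induction_on with
    | zero => simp
    | add x y hx hy => simp only [map_add, TensorProduct.add_tmul, smul_add, hx, hy]
    | tmul u v => simp

/-- `Δ((f ⊗ ι)((c ⊗ 1)Δ(a)))(1 ⊗ b)` is obtained by applying `x ↦ (f ⊗ ι)((c ⊗ 1)Δ(x))` to the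
first leg of `Δ(a)(1 ⊗ b)`. -/
theorem T₁_funId_T₂ (f : A →ₗ[ℂ] ℂ) (a b c : A) :
    H.T₁ (funId f (H.T₂ (c ⊗ₜ a)) ⊗ₜ b) =
      LinearMap.rTensor A (funId f ∘ₗ H.T₂ ∘ₗ TensorProduct.mk ℂ A A c) (H.T₁ (a ⊗ₜ b)) := by
  -- Slice the first leg of coassociativity.
  have h := congrArg (fun t => TensorProduct.lid ℂ _ (LinearMap.rTensor _ f t)) (H.T₂_T₁ a b c)
  have h1 : ∀ s : A ⊗[ℂ] A, TensorProduct.lid ℂ _ (LinearMap.rTensor _ f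
      (LinearMap.lTensor A (H.T₁ ∘ₗ (TensorProduct.mk ℂ A A).flip b) s)) =
      H.T₁ (funId f s ⊗ₜ b) := by
    intro s
    induction s using TensorProduct.induction_on with
    | zero => simp
    | add x y hx hy => simp only [map_add, TensorProduct.add_tmul, hx, hy]
    | tmul u v => simp [← TensorProduct.smul_tmul']
  have h2 : ∀ s : (A ⊗[ℂ] A) ⊗[ℂ] A, TensorProduct.lid ℂ _ (LinearMap.rTensor _ f
      (TensorProduct.assoc ℂ A A A s)) = LinearMap.rTensor A (funId f) s := by
    intro s
    induction s using TensorProduct.induction_on with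
    | zero => simp
    | add x y hx hy => simp only [map_add, hx, hy]
    | tmul u v =>
      induction u using TensorProduct.induction_on with
      | zero => simp
      | add x y hx hy => simp only [map_add, TensorProduct.add_tmul, hx, hy]
      | tmul x y => simp [TensorProduct.smul_tmul']
  simp only [h1, h2, ← LinearMap.rTensor_comp_apply] at h
  exact h.symm

end WeakMultiplierHopf

/-! ### Actions as slices, and the symmetry of pairings -/

section PairingLemmas

variable {A B : Type*} [NonUnitalRing A] [Module ℂ A] [IsScalarTower ℂ A A] [SMulCommClass ℂ A A]
  [NonUnitalRing B] [Module ℂ B] [IsScalarTower ℂ B B] [SMulCommClass ℂ B B]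
  {HA : RegularWeakMultiplierHopf A} {HB : RegularWeakMultiplierHopf B}

namespace SliceForm

variable (P : SliceForm HA HB)

/-- A slice is characterised by its products with c on either side. Left actions use only c · z,
which involves `T₂`; right actions use only z · c, which involves `T₁`. -/
theorem mul_leftAB (a : A) (b c : B) :
    c * P.leftAB a b = idFun (P.form a) (HB.T₂ (c ⊗ₜ b)) :=
  ((P.idFun_B a b).choose_spec c).2

theorem rightAB_mul (a : A) (b c : B) :
    P.rightAB b a * c = funId (P.form a) (HB.T₁ (b ⊗ₜ c)) :=
  ((P.funId_B a b).choose_spec c).1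

theorem mul_leftBA (b : B) (a c : A) :
    c * P.leftBA b a = idFun (P.form.flip b) (HA.T₂ (c ⊗ₜ a)) :=
  ((P.idFun_A b a).choose_spec c).2

theorem rightBA_mul (b : B) (a c : A) :
    P.rightBA a b * c = funId (P.form.flip b) (HA.T₁ (a ⊗ₜ c)) :=
  ((P.funId_A b a).choose_spec c).1

end SliceForm

namespace Pairing

/-- The pairing of `B` and `A` obtained from a pairing of `A` and `B`. -/
def swap (P : Pairing HA HB) : Pairing HB HA where
  form := P.form.flip
  funId_B := P.funId_A
  idFun_B := P.idFun_A
  funId_A := P.funId_B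
  idFun_A := P.idFun_B
  -- The two actions on B for the flipped form are by definition those on A for the original one,
  -- and conversely, so the axioms merely trade places.
  form_leftAB b b' a := P.form_leftBA a b b'
  form_rightAB b b' a := P.form_rightBA a b b'
  form_leftBA b a a' := P.form_leftAB a a' b
  form_rightBA b a a' := P.form_rightAB a a' b
  surj_leftAB := P.surj_leftBA
  surj_rightAB := P.surj_rightBA
  surj_leftBA := P.surj_leftAB
  surj_rightBA := P.surj_rightAB
  counit_leftBA b a := P.counit_leftAB a b
  counit_rightBA b a := P.counit_rightAB a b
  counit_leftAB b a := P.counit_leftBA a b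
  counit_rightAB b a := P.counit_rightBA a b

/-! ### Coproducts of a ▷ b and b ◁ a, and the module law -/

variable (P : Pairing HA HB)

/-- `(b' ▷ a) ▷ b = (ι ⊗ ⟨a, ·⟩)(Δ(b)(1 ⊗ b'))`. -/
theorem leftAB_leftBA (a : A) (b b' : B) :
    P.leftAB (P.leftBA b' a) b = idFun (P.form a) (HB.T₁ (b ⊗ₜ b')) := by
  refine HB.eq_of_mul_left fun c => ?_
  have h := idFun_rTensor (P.form a) (LinearMap.mulLeft ℂ c) (HB.T₁ (b ⊗ₜ b'))
  rw [LinearMap.mulLeft_apply] at h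
  -- After multiplication by c, both sides are slices of (c ⊗ 1)Δ(b)(1 ⊗ b'), bracketed in the two
  -- possible ways.
  rw [P.mul_leftAB, ← h, HB.rTensor_mulLeft_T₁]
  exact (idFun_lTensor _ _ _ (fun x => (P.form_leftBA a x b').symm) _).symm

/-- `b ◁ (a ◁ b') = (⟨a, ·⟩ ⊗ ι)((b' ⊗ 1)Δ(b))`. -/
theorem rightAB_rightBA (a : A) (b b' : B) :
    P.rightAB b (P.rightBA a b') = funId (P.form a) (HB.T₂ (b' ⊗ₜ b)) := by
  refine eq_of_mul_right HB fun c => ?_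
  have h := funId_lTensor (P.form a) (LinearMap.mulRight ℂ c) (HB.T₂ (b' ⊗ₜ b))
  rw [LinearMap.mulRight_apply] at h
  rw [P.rightAB_mul, ← h, ← HB.rTensor_mulLeft_T₁]
  exact (funId_rTensor _ _ _ (fun x => (P.form_rightBA a b' x).symm) _).symm

/-- `(c ⊗ 1)Δ(a ▷ b) = (ι ⊗ a ▷)((c ⊗ 1)Δ(b))`. -/
theorem T₂_leftAB (a : A) (b c : B) :
    HB.T₂ (c ⊗ₜ P.leftAB a b) = LinearMap.lTensor B (P.leftAB a) (HB.T₂ (c ⊗ₜ b)) := by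
  -- Writing a as a sum of b' ▷ a' supplies the factor 1 ⊗ b' that coassociativity needs.
  obtain ⟨w, rfl⟩ := P.surj_leftBA a
  induction w using TensorProduct.induction_on with
  | zero => simp
  | add x y hx hy =>
    simp only [map_add, LinearMap.add_apply, TensorProduct.tmul_add, LinearMap.lTensor_add, hx, hy]
  | tmul b' a' =>
    rw [TensorProduct.lift.tmul, P.leftAB_leftBA, HB.T₂_idFun_T₁]
    congr 2
    ext x
    exact (P.leftAB_leftBA a' x b').symm

/-- `Δ(b ◁ a)(1 ⊗ c) = (◁ a ⊗ ι)(Δ(b)(1 ⊗ c))`. -/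
theorem T₁_rightAB (a : A) (b c : B) :
    HB.T₁ (P.rightAB b a ⊗ₜ c) = LinearMap.rTensor B (P.rightAB.flip a) (HB.T₁ (b ⊗ₜ c)) := by
  obtain ⟨w, rfl⟩ := P.surj_rightBA a
  induction w using TensorProduct.induction_on with
  | zero => simp
  | add x y hx hy =>
    simp only [map_add, TensorProduct.add_tmul, LinearMap.rTensor_add, LinearMap.add_apply, hx, hy]
  | tmul a' b' =>
    rw [TensorProduct.lift.tmul, P.rightAB_rightBA, HB.T₁_funId_T₂]
    congr 2
    ext x
    exact (P.rightAB_rightBA a' x b').symm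

/-- Against c, the right side is (ι ⊗ ⟨a, a' ▷ ·⟩)((c ⊗ 1)Δ(b)), and ⟨a, a' ▷ x⟩ = ⟨aa', x⟩. -/
theorem leftAB_mul (a a' : A) (b : B) :
    P.leftAB (a * a') b = P.leftAB a (P.leftAB a' b) := by
  refine HB.eq_of_mul_left fun c => ?_
  rw [P.mul_leftAB, P.mul_leftAB, T₂_leftAB]
  exact (idFun_lTensor _ _ _ (fun x => P.form_leftAB a a' x) _).symm

theorem rightAB_mul_act (a a' : A) (b : B) :
    P.rightAB b (a * a') = P.rightAB (P.rightAB b a) a' := by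
  refine eq_of_mul_right HB fun c => ?_
  rw [P.rightAB_mul, P.rightAB_mul, T₁_rightAB]
  exact (funId_rTensor _ _ _ (fun x => P.form_rightAB a a' x) _).symm

/-! ### The product rule -/

/-- The pairing of `A ⊗ A` with `B ⊗ B`. -/
def formTensor : A ⊗[ℂ] A →ₗ[ℂ] B →ₗ[ℂ] B →ₗ[ℂ] ℂ :=
  TensorProduct.lift <| LinearMap.mk₂ ℂ
    (fun u v => (LinearMap.mul ℂ ℂ).compl₁₂ (P.form u) (P.form v))
    (fun u u' v => by ext; simp)
    (fun k u v => by ext; simp [mul_assoc])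
    (fun u v v' => by ext; simp [mul_add])
    (fun k u v => by ext; simp [mul_left_comm])

@[simp]
theorem formTensor_tmul (u v : A) (c d : B) :
    P.formTensor (u ⊗ₜ v) c d = P.form u c * P.form v d := rfl

/-- `⟨a, (p ▷ c)(q ▷ d)⟩ = ⟨Δ(a)(p ⊗ q), c ⊗ d⟩`. -/
theorem form_leftAB_mul_leftAB (a p q : A) (c d : B) :
    P.form a (P.leftAB p c * P.leftAB q d) = P.formTensor ((HA.Δ a).lmul (p ⊗ₜ q)) c d := by
  -- With x = p ▷ c the left side is ⟨(a ◁ x)q, d⟩, where (a ◁ x)q slices Δ(a)(1 ⊗ q) by ⟨·, x⟩.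
  -- Since ⟨u, p ▷ c⟩ = ⟨up, c⟩, the factor p moves into the first leg.
  rw [← P.form_rightBA, P.form_leftAB, P.rightBA_mul, HA.Δ_lmul_tmul]
  generalize HA.T₁ (a ⊗ₜ q) = t
  induction t using TensorProduct.induction_on with
  | zero => simp
  | add x y hx hy => simp only [map_add, LinearMap.add_apply, hx, hy]
  | tmul u v => simp [P.form_leftAB]

/-- `⟨a, (c ◁ p)(d ◁ q)⟩ = ⟨(p ⊗ q)Δ(a), c ⊗ d⟩`. -/
theorem form_rightAB_mul_rightAB (a p q : A) (c d : B) :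
    P.form a (P.rightAB c p * P.rightAB d q) = P.formTensor ((HA.Δ a).rmul (p ⊗ₜ q)) c d := by
  rw [← P.form_leftBA, P.form_rightAB, P.mul_leftBA, HA.Δ_rmul_tmul]
  generalize HA.T₂ (p ⊗ₜ a) = t
  induction t using TensorProduct.induction_on with
  | zero => simp
  | add x y hx hy => simp only [map_add, LinearMap.add_apply, hx, hy]
  | tmul u v => simp [P.form_rightAB, mul_comm]

/-- `∑ e c₁ d₁ ⟨w, c₂ ⊗ d₂⟩` as a function of `w ∈ A ⊗ A` and `(e ⊗ 1)Δ(c)`. -/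
def leftSum (d : B) : A ⊗[ℂ] A →ₗ[ℂ] B ⊗[ℂ] B →ₗ[ℂ] B :=
  TensorProduct.lift <| LinearMap.mk₂ ℂ
    (fun u v => LinearMap.mulRight ℂ (P.leftAB v d) ∘ₗ idFun (P.form u))
    (fun u u' v => by ext; simp [add_smul, add_mul, smul_mul_assoc])
    (fun k u v => by ext; simp [mul_smul])
    (fun u v v' => by ext; simp [mul_add])
    (fun k u v => by ext; simp [smul_comm k, mul_smul_comm])

theorem leftSum_tmul (d : B) (u v : A) (t : B ⊗[ℂ] B) :
    P.leftSum d (u ⊗ₜ v) t = idFun (P.form u) t * P.leftAB v d := rfl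

theorem mul_map₂_leftAB (w : A ⊗[ℂ] A) (c d e : B) :
    e * LinearMap.mul' ℂ B (TensorProduct.map₂ P.leftAB P.leftAB w (c ⊗ₜ d)) =
      P.leftSum d w (HB.T₂ (e ⊗ₜ c)) := by
  induction w using TensorProduct.induction_on with
  | zero => simp
  | add x y hx hy => simp only [map_add, LinearMap.add_apply, mul_add, hx, hy]
  | tmul u v =>
    rw [leftSum_tmul, ← P.mul_leftAB, TensorProduct.map₂_apply_tmul, TensorProduct.map_tmul,
      LinearMap.mul'_apply, mul_assoc]

/-- With f ⊗ g standing for a term of (e ⊗ 1)Δ(c), the factor f covers Δ(d) in turn, so two nested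
coverings suffice for ∑ e c₁ d₁ ⟨w, c₂ ⊗ d₂⟩. -/
theorem leftSum_apply_tmul (w : A ⊗[ℂ] A) (d f g : B) :
    P.leftSum d w (f ⊗ₜ g) = idFun (P.formTensor w g) (HB.T₂ (f ⊗ₜ d)) := by
  induction w using TensorProduct.induction_on with
  | zero => simp [idFun]
  | add x y hx hy => simp only [map_add, LinearMap.add_apply, idFun_add, hx, hy]
  | tmul u v =>
    rw [leftSum_tmul, idFun_tmul, smul_mul_assoc, P.mul_leftAB, ← idFun_smul]
    rfl

/-- Against e, both sides become ∑ e c₁ d₁ times a scalar: ⟨a, (p ▷ c₂)(q ▷ d₂)⟩ on the left,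
⟨Δ(a)(p ⊗ q), c₂ ⊗ d₂⟩ on the right. These agree by `form_leftAB_mul_leftAB`. -/
theorem leftAB_act_mul (a p q : A) (c d : B) :
    P.leftAB a (P.leftAB p c * P.leftAB q d) = LinearMap.mul' ℂ B
      (TensorProduct.map₂ P.leftAB P.leftAB ((HA.Δ a).lmul (p ⊗ₜ q)) (c ⊗ₜ d)) := by
  refine HB.eq_of_mul_left fun e => ?_
  rw [mul_map₂_leftAB, P.mul_leftAB, HB.T₂_mul, T₂_leftAB]
  generalize HB.T₂ (e ⊗ₜ c) = t
  induction t using TensorProduct.induction_on with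
  | zero => simp
  | add x y hx hy => simp only [map_add, hx, hy]
  | tmul f g =>
    rw [leftSum_apply_tmul, LinearMap.lTensor_tmul, HB.Δ_rmul_tmul, T₂_leftAB,
      ← LinearMap.lTensor_comp_apply]
    exact idFun_lTensor _ _ _ (fun x => P.form_leftAB_mul_leftAB a p q g x) _

/-- `∑ ⟨w, c₁ ⊗ d₁⟩ c₂ d₂ e` as a function of `w ∈ A ⊗ A` and `Δ(d)(1 ⊗ e)`. -/
def rightSum (c : B) : A ⊗[ℂ] A →ₗ[ℂ] B ⊗[ℂ] B →ₗ[ℂ] B :=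
  TensorProduct.lift <| LinearMap.mk₂ ℂ
    (fun u v => LinearMap.mulLeft ℂ (P.rightAB c u) ∘ₗ funId (P.form v))
    (fun u u' v => by ext; simp [add_mul])
    (fun k u v => by ext; simp [smul_comm k, smul_mul_assoc])
    (fun u v v' => by ext; simp [add_smul, mul_add, mul_smul_comm])
    (fun k u v => by ext; simp [mul_smul])

theorem rightSum_tmul (c : B) (u v : A) (t : B ⊗[ℂ] B) :
    P.rightSum c (u ⊗ₜ v) t = P.rightAB c u * funId (P.form v) t := rfl

theorem map₂_rightAB_mul (w : A ⊗[ℂ] A) (c d e : B) :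
    LinearMap.mul' ℂ B (TensorProduct.map₂ P.rightAB P.rightAB (c ⊗ₜ d) w) * e =
      P.rightSum c w (HB.T₁ (d ⊗ₜ e)) := by
  induction w using TensorProduct.induction_on with
  | zero => simp
  | add x y hx hy => simp only [map_add, LinearMap.add_apply, add_mul, hx, hy]
  | tmul u v =>
    rw [rightSum_tmul, ← P.rightAB_mul, TensorProduct.map₂_apply_tmul, TensorProduct.map_tmul,
      LinearMap.mul'_apply, mul_assoc]

theorem rightSum_apply_tmul (w : A ⊗[ℂ] A) (c g f : B) :
    P.rightSum c w (g ⊗ₜ f) = funId ((P.formTensor w).flip g) (HB.T₁ (c ⊗ₜ f)) := by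
  induction w using TensorProduct.induction_on with
  | zero =>
    have h : (P.formTensor 0).flip g = 0 := by ext; simp
    rw [h]
    simp [funId]
  | add x y hx hy =>
    have h : (P.formTensor (x + y)).flip g = (P.formTensor x).flip g + (P.formTensor y).flip g := by
      ext; simp
    rw [h, funId_add, ← hx, ← hy, map_add, LinearMap.add_apply]
  | tmul u v =>
    have h : (P.formTensor (u ⊗ₜ v)).flip g = P.form v g • P.form u := by ext; simp [mul_comm]
    rw [h, rightSum_tmul, funId_tmul, mul_smul_comm, P.rightAB_mul, ← funId_smul]

/-- Mirror image of `leftAB_act_mul`. Here e covers from the right, so Δ(d)(1 ⊗ e) is expanded first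
and its second leg f then covers Δ(c). -/
theorem rightAB_act_mul (a p q : A) (c d : B) :
    P.rightAB (P.rightAB c p * P.rightAB d q) a = LinearMap.mul' ℂ B
      (TensorProduct.map₂ P.rightAB P.rightAB (c ⊗ₜ d) ((HA.Δ a).rmul (p ⊗ₜ q))) := by
  refine eq_of_mul_right HB fun e => ?_
  rw [map₂_rightAB_mul, P.rightAB_mul, HB.T₁_mul, T₁_rightAB]
  generalize HB.T₁ (d ⊗ₜ e) = t
  induction t using TensorProduct.induction_on with
  | zero => simp
  | add x y hx hy => simp only [map_add, hx, hy]
  | tmul g f =>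
    rw [rightSum_apply_tmul, LinearMap.rTensor_tmul, HB.Δ_lmul_tmul, T₁_rightAB,
      ← LinearMap.rTensor_comp_apply]
    exact funId_rTensor _ _ _ (fun x => P.form_rightAB_mul_rightAB a p q x g) _

/-! ### Module algebra structures -/

theorem isLeftModuleAlgebra_leftAB :
    IsLeftModuleAlgebra HA.toWeakMultiplierHopf P.leftAB where
  mul_act := P.leftAB_mul
  unital := P.surj_leftAB
  act_mul := by
    rintro a x y s ⟨w, hw, rfl⟩
    -- Proved for all w, hence for any way of writing x ⊗ y as a sum of (p ▷ c) ⊗ (q ▷ d);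
    -- independence of that choice need not be settled separately.
    have key : ∀ w : (A ⊗[ℂ] A) ⊗[ℂ] (B ⊗[ℂ] B),
        P.leftAB a (LinearMap.mul' ℂ B
          (TensorProduct.lift (TensorProduct.map₂ P.leftAB P.leftAB) w)) =
        LinearMap.mul' ℂ B (TensorProduct.lift (TensorProduct.map₂ P.leftAB P.leftAB)
          (LinearMap.rTensor (B ⊗[ℂ] B) (HA.Δ a).lmul w)) := by
      intro w
      induction w using TensorProduct.induction_on with
      | zero => simp
      | add w w' h h' => simp only [map_add, h, h']
      | tmul u v =>
        induction u using TensorProduct.induction_on with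
        | zero => simp
        | add u u' h h' => simp only [TensorProduct.add_tmul, map_add, h, h']
        | tmul p q =>
          induction v using TensorProduct.induction_on with
          | zero => simp
          | add v v' h h' => simp only [TensorProduct.tmul_add, map_add, h, h']
          | tmul c d => exact P.leftAB_act_mul a p q c d
    rw [← key, hw, LinearMap.mul'_apply]

theorem isRightModuleAlgebra_rightAB :
    IsRightModuleAlgebra HA.toWeakMultiplierHopf P.rightAB where
  act_mul := P.rightAB_mul_act
  unital := P.surj_rightAB
  mul_act := by
    rintro a x y s ⟨w, hw, rfl⟩
    have key : ∀ w : (B ⊗[ℂ] B) ⊗[ℂ] (A ⊗[ℂ] A),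
        P.rightAB (LinearMap.mul' ℂ B
          (TensorProduct.lift (TensorProduct.map₂ P.rightAB P.rightAB) w)) a =
        LinearMap.mul' ℂ B (TensorProduct.lift (TensorProduct.map₂ P.rightAB P.rightAB)
          (LinearMap.lTensor (B ⊗[ℂ] B) (HA.Δ a).rmul w)) := by
      intro w
      induction w using TensorProduct.induction_on with
      | zero => simp
      | add w w' h h' => simp only [map_add, LinearMap.add_apply, h, h']
      | tmul v u =>
        induction u using TensorProduct.induction_on with
        | zero => simp
        | add u u' h h' =>
          simp only [TensorProduct.tmul_add, map_add, LinearMap.add_apply, h, h']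
        | tmul p q =>
          induction v using TensorProduct.induction_on with
          | zero => simp
          | add v v' h h' =>
            simp only [TensorProduct.add_tmul, map_add, LinearMap.add_apply, h, h']
          | tmul c d => exact P.rightAB_act_mul a p q c d
    rw [← key, hw, LinearMap.mul'_apply]

end Pairing

end PairingLemmas

end WMHopf

end

theorem mainTheorem10 {A B : Type*}
    [NonUnitalRing A] [Module ℂ A] [IsScalarTower ℂ A A] [SMulCommClass ℂ A A]
    [NonUnitalRing B] [Module ℂ B] [IsScalarTower ℂ B B] [SMulCommClass ℂ B B]
    (HA : WMHopf.RegularWeakMultiplierHopf A) (HB : WMHopf.RegularWeakMultiplierHopf B)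
    (P : WMHopf.Pairing HA HB) :
    WMHopf.IsLeftModuleAlgebra HA.toWeakMultiplierHopf P.leftAB ∧
    WMHopf.IsRightModuleAlgebra HA.toWeakMultiplierHopf P.rightAB ∧
    WMHopf.IsLeftModuleAlgebra HB.toWeakMultiplierHopf P.leftBA ∧
    WMHopf.IsRightModuleAlgebra HB.toWeakMultiplierHopf P.rightBA :=
  ⟨P.isLeftModuleAlgebra_leftAB, P.isRightModuleAlgebra_rightAB,
    P.swap.isLeftModuleAlgebra_leftAB, P.swap.isRightModuleAlgebra_rightAB⟩
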